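/- Let $G$ be a locally compact, second countable, Hausdorff topological group with left Haar measure $\lambda$, and let $\mathbf X,\mathbf Y$ be topological spaces whose Borel $\sigma$-algebras are standard Borel, on each of which $G$ acts continuously. Assume that the action on $\mathbf X$ is proper: there is a measurable $h\colon\mathbf X\to(0,\infty)$ with $\int_G h(gx)\,\lambda(dg)<\infty$ for every $x\in\mathbf X$. Let $X,Y$ be random elements of $\mathbf X,\mathbf Y$ on a common probability space, and let $P_X$ be the distribution of $X$. **Terminology.** Below, *measurable* functions of $x\in\mathbf X$ are measurable with respect to the $P_X$-completion of the Borel $\sigma$-algebra, and the properties defining them may fail for $x$ in a $P_X$-null set $\mathcal N$ (put $S=\mathbf X\setminus\mathcal N$). * A *maximal invariant* is a measurable map $M$ from $\mathbf X$ to a standard Borel space such that, for $x,x'\in S$, $M(x)=M(x')$ if and only if $x,x'$ lie on the same $G$-orbit. * An *orbit selector* is a measurable map $\gamma\colon\mathbf X\to\mathbf X$ such that $\gamma(x)\in Gx$ for $x\in S$, and $\gamma(x)=\gamma(x')$ whenever $x,x'\in S$ lie on the same orbit. * An *inversion kernel* associated with $\gamma$ is a measurable family $(\zeta(x,\cdot))_{x\in\mathbf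 X}$ of measures on $G$ such that for all $x\in S$: $\zeta(x,\cdot)$ is a probability measure; $\zeta(gx,B)=\zeta(x,g^{-1}B)$ for all $g\in G$ and Borel $B\subseteq G$; $\zeta(\gamma(x),\cdot)$ is the normalized Haar measure of the stabilizer of $\gamma(x)$; and $t\gamma(x)=x$ for $\zeta(x,\cdot)$-almost every $t$. * A *representative inversion* associated with $\gamma$ is a measurable map $\tau\colon\mathbf X\to G$ such that $\tau(x)\gamma(x)=x$ and $\tau(gx)=g\tau(x)$ for all $x\in S$, $g\in G$. * The conditional distribution $P_{Y|X}$ is *$G$-equivariant* if it has a regular version, i.e. a Borel Markov kernel $Q$ from $\mathbf X$ to $\mathbf Y$ with $P_{X,Y}=P_X\otimes Q$, such that $Q(x,B)=Q(gx,gB)$ for all $x\in\mathbf X$, $g\in G$ and Borel $B\subseteq\mathbf Y$. **Theorem.** There exist an orbit selector $\gamma$ and an inversion kernel $\zeta$ associated with it (even with $\mathcal N=\emptyset$). Moreover, for every maximal invariant $M$: 1. Let $\zeta$ be an inversion kernel associated with an orbit selector, and let $\tilde\tau$ be a random element of $G$, on the same probability space, that is drawn from $\zeta(X,\cdot)$,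 i.e. whose conditional distribution given $(X,Y)$ is $\zeta(X,\cdot)$. Then $P_{Y|X}$ is $G$-equivariant if and only if $$(\tilde\tau,X)\perp\!\!\!\perp\tilde\tau^{-1}Y\mid M(X).$$ 2. If $\tau$ is a representative inversion associated with an orbit selector, then $P_{Y|X}$ is $G$-equivariant if and only if $X\perp\!\!\!\perp\tau(X)^{-1}Y\mid M(X)$. 3. If $G$ acts trivially on $\mathbf Y$, then $P_{Y|X}$ is $G$-equivariant if and only if $X\perp\!\!\!\perp Y\mid M(X)$. -/

import Mathlib

open MeasureTheory ProbabilityTheory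
open scoped Pointwise ENNReal

/-- The action of `G` on `E` is proper: some strictly positive measurable function `h` on `E` has
`∫ h (g x) λ(dg) < ∞` for every `x`, where `λ` is a left Haar measure of `G`. -/
def IsProperAction (G E : Type*) [Group G] [TopologicalSpace G] [IsTopologicalGroup G]
    [LocallyCompactSpace G] [MeasurableSpace G] [BorelSpace G]
    [MeasurableSpace E] [MulAction G E] : Prop :=
  ∃ h : E → ℝ, Measurable h ∧ (∀ x, 0 < h x) ∧
    ∀ x, ∫⁻ g : G, ENNReal.ofReal (h (g • x)) ∂Measure.haar < ∞

/-- `M` is a maximal invariant on `S`: two points of `S` have the same value exactly when they lie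
on the same orbit. `S = Set.univ` is the plain notion; a smaller `S` of full measure allows an
exceptional null set. -/
def IsMaximalInvariantOn (G : Type*) {E F : Type*} [Group G] [MulAction G E]
    (S : Set E) (M : E → F) : Prop :=
  ∀ x ∈ S, ∀ x' ∈ S, M x = M x' ↔ x ∈ MulAction.orbit G x'

/-- `γ` is an orbit selector on `S`: it maps each point to a point of its orbit, the same one for
all points of the orbit. -/
def IsOrbitSelectorOn (G : Type*) {E : Type*} [Group G] [MulAction G E]
    (S : Set E) (γ : E → E) : Prop :=
  (∀ x ∈ S, γ x ∈ MulAction.orbit G x) ∧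
    ∀ x ∈ S, ∀ x' ∈ S, x ∈ MulAction.orbit G x' → γ x = γ x'

/-- `ν` is the normalized Haar measure of the subgroup `H`, regarded as a measure on `G`. -/
def IsNormalizedHaarOf {G : Type*} [Group G] [TopologicalSpace G] [MeasurableSpace G]
    (H : Subgroup G) (ν : Measure G) : Prop :=
  ∃ η : Measure H, η.IsHaarMeasure ∧ IsProbabilityMeasure η ∧ ν = η.map Subtype.val

/-- `ζ` is an inversion kernel on `S`, associated with the orbit selector `γ`. (The measurability
of `x ↦ ζ x` is a separate assumption.) -/
structure IsInversionKernelOn {G E : Type*} [Group G] [TopologicalSpace G] [MeasurableSpace G]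
    [MulAction G E] (S : Set E) (γ : E → E) (ζ : E → Measure G) : Prop where
  isProb : ∀ x ∈ S, IsProbabilityMeasure (ζ x)
  equivariant : ∀ x ∈ S, ∀ g : G, ∀ B : Set G, MeasurableSet B → ζ (g • x) B = ζ x (g⁻¹ • B)
  haar : ∀ x ∈ S, IsNormalizedHaarOf (MulAction.stabilizer G (γ x)) (ζ (γ x))
  inverts : ∀ x ∈ S, ∀ᵐ t ∂ζ x, t • γ x = x

/-- `τ` is a representative inversion on `S`, associated with the orbit selector `γ`. -/
def IsRepresentativeInversionOn {G E : Type*} [Group G] [MulAction G E]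
    (S : Set E) (γ : E → E) (τ : E → G) : Prop :=
  ∀ x ∈ S, τ x • γ x = x ∧ ∀ g : G, τ (g • x) = g * τ x

/-- The conditional distribution of `Y` given `X` is `G`-equivariant: it has a regular version `Q`
with `Q (x, B) = Q (g x, g B)` for all `g`, `x` and measurable `B`. -/
def CondDistribEquivariant (G : Type*) {E F Ω : Type*} [Group G]
    [MeasurableSpace E] [MeasurableSpace F] [MulAction G E] [MulAction G F]
    [MeasurableSpace Ω] (μ : Measure Ω) (X : Ω → E) (Y : Ω → F) : Prop :=
  ∃ Q : Kernel E F, IsMarkovKernel Q ∧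
    μ.map (fun ω => (X ω, Y ω)) = μ.map X ⊗ₘ Q ∧
    ∀ (g : G) (x : E) (B : Set F), MeasurableSet B → Q x B = Q (g • x) (g • B)

/-- Conditionally on `(X, Y)`, the random element `T` has distribution `ζ X`; that is, `T` given
`X` is drawn from `ζ X`, with no further dependence on `Y`. -/
def IsDrawnFrom {E F H Ω : Type*} [MeasurableSpace E] [MeasurableSpace F] [MeasurableSpace H]
    [MeasurableSpace Ω] (μ : Measure Ω) (X : Ω → E) (Y : Ω → F) (ζ : E → Measure H)
    (T : Ω → H) : Prop :=
  ∀ (A : Set (E × F)) (B : Set H), MeasurableSet A → MeasurableSet B →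
    μ {ω | (X ω, Y ω) ∈ A ∧ T ω ∈ B} = ∫⁻ ω in {ω | (X ω, Y ω) ∈ A}, ζ (X ω) B ∂μ

/-- Conditional independence `U ⊥ V | W` of random elements of standard Borel spaces, measurable up
to null sets: the regular conditional distribution of `(U, V)` given `W` is a product. -/
def CondIndepGiven {A B C Ω : Type*} [MeasurableSpace A] [MeasurableSpace B] [MeasurableSpace C]
    [MeasurableSpace Ω] (μ : Measure Ω) (U : Ω → A) (V : Ω → B) (W : Ω → C) : Prop :=
  ∃ (κ : Kernel C A) (η : Kernel C B), IsMarkovKernel κ ∧ IsMarkovKernel η ∧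
    μ.map (fun ω => (W ω, U ω, V ω)) = μ.map W ⊗ₘ (κ ×ₖ η)

/-! Properness gives each `x` a probability measure on `G`: normalize `h (g • x) λ(dg)`. The
resulting kernel `W` satisfies `W (k • x) = (W x).map (· * k⁻¹)` because the modular factor cancels.
Everything about orbits is extracted from `W`. The law of `g • x` under `W x` depends only on the
orbit and is carried by it, which yields a Borel maximal invariant. Conditioning `g` on `g • s`
under `W s`, then averaging over `W x`, yields a kernel `Z (s, x)` on the elements taking `s` to
`x`, equivariant in `x` (`exists_orbit_inversion_kernel`). With an almost-everywhere section of the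
invariant this gives `γ` and `ζ x = Z (γ x, x)`.

Since `M (X)` is a function of `X`, the conditional independence says that the law of `T⁻¹ Y` given
`(T, X)` depends only on `M (X)` (`condIndepGiven_iff_exists_kernel`). If `Q` is an equivariant
version, then `t • γ x = x` gives `Q x = t_* Q (γ x)`, so `T⁻¹ Y` has law `Q (γ x)`, a function of
`M x`. Conversely, if `T⁻¹ Y` has law `η (M x)`, writing `Y = T (T⁻¹ Y)` produces a version
equivariant on a set of full measure, and `Z` extends it to one equivariant everywhere
(`exists_equivariant_kernel_ae_eq`). A representative inversion is the case of Dirac kernels; for a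
trivial action, equivariance is constancy on orbits. -/

/-- A locally compact, second countable, Hausdorff group is Polish. -/
theorem polishSpace_of_locallyCompact_group (G : Type*) [Group G] [TopologicalSpace G]
    [IsTopologicalGroup G] [LocallyCompactSpace G] [SecondCountableTopology G] [T2Space G] :
    PolishSpace G := by
  -- Local compactness makes the right uniformity complete and a countable base at 1 makes it
  -- countably generated; hence a complete metric.
  let _ : UniformSpace G := IsTopologicalGroup.rightUniformSpace G
  have : IsRightUniformGroup G := { toIsTopologicalGroup := inferInstance, uniformity_eq := rfl }
  have hcomplete : CompleteSpace G := IsRightUniformGroup.completeSpace_of_weaklyLocallyCompactSpace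
  have : (uniformity G).IsCountablyGenerated := by
    rw [uniformity_eq_comap_nhds_one]
    infer_instance
  have : TopologicalSpace.IsCompletelyMetrizableSpace G :=
    ⟨UniformSpace.metricSpace G, rfl, hcomplete⟩
  exact {}

/-! ### Equivariant probability weights from a proper action -/

section HaarWeights

variable {G E : Type*} [Group G] [TopologicalSpace G] [IsTopologicalGroup G]
  [LocallyCompactSpace G] [SecondCountableTopology G] [MeasurableSpace G] [BorelSpace G]

/-- A right translate of left Haar measure is again left Haar, so uniqueness makes it a multiple;
`c` is a value of the modular function. -/
theorem exists_lintegral_mul_right_haar (k : G) :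
    ∃ c : ℝ≥0∞, c ≠ 0 ∧ c ≠ ∞ ∧ ∀ f : G → ℝ≥0∞, Measurable f →
      ∫⁻ g, f (g * k) ∂(Measure.haar : Measure G) = c * ∫⁻ g, f g ∂(Measure.haar : Measure G) := by
  refine ⟨(Measure.haarScalarFactor (Measure.map (· * k) (Measure.haar : Measure G))
    Measure.haar : NNReal), ?_, ENNReal.coe_ne_top, fun f hf => ?_⟩
  · exact ENNReal.coe_ne_zero.2 (Measure.haarScalarFactor_pos_of_isHaarMeasure _ _).ne'
  · rw [← lintegral_map (f := f) hf (measurable_mul_const k)]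
    conv_lhs => rw [Measure.isMulLeftInvariant_eq_smul (Measure.map (· * k)
      (Measure.haar : Measure G)) Measure.haar]
    rw [lintegral_smul_measure]
    rfl

/-- For a proper action, each point has a probability measure on `G`, in a measurable and
equivariant way. -/
theorem IsProperAction.exists_equivariant_kernel [MeasurableSpace E] [MulAction G E]
    [MeasurableSMul₂ G E] (hp : IsProperAction G E) :
    ∃ W : Kernel E G, IsMarkovKernel W ∧
      ∀ (k : G) (x : E), W (k • x) = (W x).map (fun g => g * k⁻¹) := by
  obtain ⟨h, hm, hpos, hfin⟩ := hp
  set H : E → ℝ≥0∞ := fun x => ∫⁻ g : G, ENNReal.ofReal (h (g • x)) ∂Measure.haar with hH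
  have hjm : Measurable (Function.uncurry fun (x : E) (g : G) => ENNReal.ofReal (h (g • x))) := by
    unfold Function.uncurry
    fun_prop
  have hHm : Measurable H := hjm.lintegral_prod_right'
  have hH0 : ∀ x, H x ≠ 0 := by
    intro x hx
    have hx' := (lintegral_eq_zero_iff (hjm.of_uncurry_left (x := x))).1 hx
    have : (Measure.haar : Measure G) Set.univ = 0 := by
      rw [Measure.measure_univ_eq_zero, ← ae_eq_bot, ← Filter.eventually_false_iff_eq_bot]
      filter_upwards [hx'] with g hg
      exact absurd hg (by simpa using hpos (g • x))
    exact (isOpen_univ.measure_ne_zero Measure.haar Set.univ_nonempty) this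
  set f : E → G → ℝ≥0∞ := fun x g => (H x)⁻¹ * ENNReal.ofReal (h (g • x)) with hf
  have hfm : Measurable (Function.uncurry f) := by
    have : Measurable fun p : E × G => (H p.1)⁻¹ := (hHm.comp measurable_fst).inv
    exact this.mul hjm
  let W : Kernel E G := (Kernel.const E (Measure.haar : Measure G)).withDensity f
  have hW : ∀ x (u : G → ℝ≥0∞), Measurable u →
      ∫⁻ g, u g ∂W x = (H x)⁻¹ * ∫⁻ g, ENNReal.ofReal (h (g • x)) * u g ∂Measure.haar := by
    intro x u hu
    rw [Kernel.lintegral_withDensity _ hfm _ hu, ← lintegral_const_mul]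
    · simp [hf, mul_assoc]
    · exact (hjm.of_uncurry_left (x := x)).mul hu
  refine ⟨W, ⟨fun x => ⟨?_⟩⟩, fun k x => ?_⟩
  · rw [← lintegral_one, hW x _ measurable_const]
    simp only [mul_one]
    exact ENNReal.inv_mul_cancel (hH0 x) (hfin x).ne
  · have hlin : ∀ u : G → ℝ≥0∞, Measurable u →
        ∫⁻ g, u g ∂W (k • x) = ∫⁻ g, u g ∂((W x).map fun g => g * k⁻¹) := by
      intro u hu
      obtain ⟨c, hc0, hct, hc⟩ := exists_lintegral_mul_right_haar k
      have hxm := hjm.of_uncurry_left (x := x)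
      have hHk : H (k • x) = c * H x := by
        rw [hH]
        simp only [← mul_smul]
        exact hc _ hxm
      rw [lintegral_map hu (measurable_mul_const _), hW _ _ hu,
        hW x (fun g => u (g * k⁻¹)) (hu.comp (measurable_mul_const _)), hHk]
      -- Substituting `g * k` for `g` moves `k` out of `h`; the factor `c` this costs cancels the
      -- one in `H (k • x) = c * H x`.
      have := hc (fun g => ENNReal.ofReal (h (g • x)) * u (g * k⁻¹))
        (hxm.mul (hu.comp (measurable_mul_const _)))
      simp only [mul_inv_cancel_right] at this
      simp only [← mul_smul]
      rw [this, ENNReal.mul_inv (.inl hc0) (.inl hct), mul_comm c⁻¹, mul_assoc, ← mul_assoc c⁻¹,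
        ENNReal.inv_mul_cancel hc0 hct, one_mul]
    ext B hB
    simpa [lintegral_indicator_one hB] using hlin (B.indicator 1) (measurable_one.indicator hB)

end HaarWeights

/-! ### A Borel maximal invariant -/

section MeasurableActions

variable {G E : Type*} [Group G] [MeasurableSpace G] [StandardBorelSpace G]
  [MeasurableMul₂ G]
  [MeasurableSpace E] [StandardBorelSpace E] [MulAction G E] [MeasurableSMul₂ G E]

/-- An equivariant Markov kernel yields a Borel map that separates the orbits. -/
theorem exists_measurable_orbit_invariant (W : Kernel E G) [IsMarkovKernel W]
    (hW : ∀ (k : G) (x : E), W (k • x) = (W x).map (fun g => g * k⁻¹)) :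
    ∃ M : E → ℝ, Measurable M ∧ ∀ x y, M x = M y ↔ x ∈ MulAction.orbit G y := by
  set m : E → Measure E := fun x => (W x).map (fun g => g • x) with hm
  have hsm : ∀ x : E, Measurable fun g : G => g • x := fun x => measurable_smul_const x
  have hprob : ∀ x, IsProbabilityMeasure (m x) := fun x =>
    Measure.isProbabilityMeasure_map (hsm x).aemeasurable
  have hinv : ∀ (k : G) x, m (k • x) = m x := by
    intro k x
    simp only [hm, hW]
    rw [Measure.map_map (hsm _) (measurable_mul_const _)]
    congr 1
    ext g
    simp [mul_smul]
  have hmeas : ∀ A : Set E, MeasurableSet A → Measurable fun x => m x A := by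
    intro A hA
    have : MeasurableSet {p : E × G | p.2 • p.1 ∈ A} :=
      (measurable_snd.smul measurable_fst) hA
    have := Kernel.measurable_kernel_prodMk_left (κ := W) this
    convert this using 2 with x
    simp only [hm]
    rw [Measure.map_apply (hsm x) hA]
    rfl
  -- Orbits are analytic, so distinct ones are separated by a Borel set, to which `m x` and `m y`
  -- give masses 1 and 0.
  have hsep : ∀ x y, m x = m y → x ∈ MulAction.orbit G y := by
    intro x y hxy
    by_contra hne
    let _ := upgradeStandardBorel E
    have han : ∀ z : E, AnalyticSet (MulAction.orbit G z) := by
      intro z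
      have := MeasurableSet.univ.analyticSet_image (hsm z)
      rwa [Set.image_univ] at this
    have hdis : Disjoint (MulAction.orbit G x) (MulAction.orbit G y) := by
      rw [Set.disjoint_left]
      intro z hzx hzy
      apply hne
      rw [← MulAction.orbit_eq_iff] at hzx hzy ⊢
      rw [← hzx, hzy]
    obtain ⟨B, hxB, hyB, hB⟩ := (han x).measurablySeparable (han y) hdis
    have h1 : m x B = 1 := by
      simp only [hm]
      rw [Measure.map_apply (hsm x) hB]
      have : (fun g : G => g • x) ⁻¹' B = Set.univ :=
        Set.eq_univ_of_forall fun g => hxB (MulAction.mem_orbit x g)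
      simp [this]
    have h2 : m y B = 0 := by
      simp only [hm]
      rw [Measure.map_apply (hsm y) hB]
      have : (fun g : G => g • y) ⁻¹' B = ∅ :=
        Set.eq_empty_of_forall_notMem fun g hg =>
          Set.disjoint_left.1 hyB (MulAction.mem_orbit y g) hg
      simp [this]
    rw [hxy, h2] at h1
    exact zero_ne_one h1
  have he := measurableEmbedding_embeddingReal E
  -- The distribution function at rational points encodes `m x` in a standard Borel space, which
  -- then embeds in `ℝ`.
  set c : E → ℚ → ℝ≥0∞ := fun x q => m x (embeddingReal E ⁻¹' Set.Iic (q : ℝ)) with hc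
  have hcm : Measurable c :=
    measurable_pi_lambda _ fun q => hmeas _ (he.measurable measurableSet_Iic)
  have hcinj : ∀ x y, c x = c y → m x = m y := by
    intro x y hxy
    have : (m x).map (embeddingReal E) = (m y).map (embeddingReal E) := by
      have := Measure.isProbabilityMeasure_map (μ := m x) he.measurable.aemeasurable
      refine ext_of_generate_finite _ (BorelSpace.measurable_eq.trans Real.borel_eq_generateFrom_Iic_rat)
        Real.isPiSystem_Iic_rat ?_ ?_
      · intro s hs
        obtain ⟨q, rfl⟩ := by simpa using hs
        rw [Measure.map_apply he.measurable measurableSet_Iic,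
          Measure.map_apply he.measurable measurableSet_Iic]
        exact congrFun hxy q
      · rw [Measure.map_apply he.measurable .univ, Measure.map_apply he.measurable .univ]
        simp
    rw [← he.comap_map (m x), ← he.comap_map (m y), this]
  have he' := measurableEmbedding_embeddingReal (ℚ → ℝ≥0∞)
  refine ⟨fun x => embeddingReal _ (c x), he'.measurable.comp hcm, fun x y => ⟨fun h => ?_, ?_⟩⟩
  · exact hsep _ _ (hcinj _ _ (he'.injective h))
  · rintro ⟨k, rfl⟩
    simp only [hc, hinv]

end MeasurableActions

/-! ### Measurable selection and factorization up to null sets -/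

theorem exists_measurableSet_of_ae {α : Type*} [MeasurableSpace α] {P : Measure α} {p : α → Prop}
    (h : ∀ᵐ x ∂P, p x) : ∃ S : Set α, MeasurableSet S ∧ P Sᶜ = 0 ∧ ∀ x ∈ S, p x := by
  refine ⟨(toMeasurable P {x | ¬ p x})ᶜ, (measurableSet_toMeasurable _ _).compl, ?_, ?_⟩
  · rw [compl_compl, measure_toMeasurable]
    exact h
  · intro x hx
    by_contra hn
    exact hx (subset_toMeasurable _ _ hn)

/-- The least point of each fiber works: its minimum is at most `c` exactly on the projection of a
compact set, which is closed. -/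
theorem IsCompact.exists_measurable_fiber_section {K : Set (ℝ × ℝ)} (hK : IsCompact K) :
    ∃ u : ℝ → ℝ, Measurable u ∧ ∀ m ∈ Prod.fst '' K, (m, u m) ∈ K := by
  have hfib : ∀ m, IsCompact {a : ℝ | (m, a) ∈ K} := by
    intro m
    have : {a : ℝ | (m, a) ∈ K} = Prod.snd '' (K ∩ Prod.fst ⁻¹' {m}) := by
      ext a
      simp
    rw [this]
    exact (hK.inter_right (isClosed_singleton.preimage continuous_fst)).image continuous_snd
  have hmem : ∀ m ∈ Prod.fst '' K, (m, sInf {a : ℝ | (m, a) ∈ K}) ∈ K := by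
    rintro m ⟨⟨m', a⟩, ha, rfl⟩
    exact (hfib m').sInf_mem ⟨a, ha⟩
  have hproj : ∀ c : ℝ, MeasurableSet (Prod.fst '' (K ∩ Prod.snd ⁻¹' Set.Iic c)) := fun c =>
    ((hK.inter_right (isClosed_Iic.preimage continuous_snd)).image
      continuous_fst).isClosed.measurableSet
  have hKm : MeasurableSet (Prod.fst '' K) := (hK.image continuous_fst).isClosed.measurableSet
  refine ⟨fun m => sInf {a : ℝ | (m, a) ∈ K}, measurable_of_Iic fun c => ?_, hmem⟩
  -- Over an empty fiber `sInf ∅ = 0`, whence the second set of the union.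
  have hset : (fun m => sInf {a : ℝ | (m, a) ∈ K}) ⁻¹' Set.Iic c =
      Prod.fst '' (K ∩ Prod.snd ⁻¹' Set.Iic c) ∪ ((Prod.fst '' K)ᶜ ∩ {_m | 0 ≤ c}) := by
    ext m
    by_cases hm : m ∈ Prod.fst '' K
    · simp only [Set.mem_preimage, Set.mem_Iic, Set.mem_union, Set.mem_inter_iff, Set.mem_compl_iff,
        hm, not_true_eq_false, false_and, or_false]
      constructor
      · intro h
        exact ⟨_, ⟨hmem m hm, h⟩, rfl⟩
      · rintro ⟨⟨m', a⟩, ⟨ha, hac⟩, rfl⟩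
        exact (csInf_le (hfib m').bddBelow ha).trans hac
    · have hempty : {a : ℝ | (m, a) ∈ K} = ∅ :=
        Set.eq_empty_of_forall_notMem fun a ha => hm ⟨_, ha, rfl⟩
      have hnot : m ∉ Prod.fst '' (K ∩ Prod.snd ⁻¹' Set.Iic c) := by
        rintro ⟨p, hp, rfl⟩
        exact hm ⟨p, hp.1, rfl⟩
      simp only [Set.mem_preimage, Set.mem_Iic, Set.mem_union, Set.mem_inter_iff, Set.mem_compl_iff,
        hm, hnot, not_false_eq_true, true_and, false_or, hempty, Real.sInf_empty, Set.mem_ofPred_eq]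
  rw [hset]
  exact (hproj c).union (hKm.compl.inter (MeasurableSet.const _))

/-- Measurable selection up to null sets: a Borel function on a standard Borel space with a finite
measure has a Borel section, with values in a prescribed set of full measure. -/
theorem exists_measurable_ae_section {E : Type*} [MeasurableSpace E] [StandardBorelSpace E]
    [Nonempty E] (P : Measure E) [IsFiniteMeasure P] {M : E → ℝ} (hM : Measurable M)
    {S : Set E} (hS : MeasurableSet S) (hPS : P Sᶜ = 0) :
    ∃ s : ℝ → E, Measurable s ∧ ∀ᵐ x ∂P, M (s (M x)) = M x ∧ s (M x) ∈ S := by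
  classical
  have he := measurableEmbedding_embeddingReal E
  -- The graph embedding makes `S` a Borel subset of the plane, which compact sets exhaust up to
  -- measure zero; sections over these compacts are then glued.
  set f : E → ℝ × ℝ := fun x => (M x, embeddingReal E x) with hf
  have hfm : Measurable f := hM.prodMk he.measurable
  have hfe : MeasurableEmbedding f :=
    hfm.measurableEmbedding fun x y h => he.injective (Prod.ext_iff.1 h).2
  have hT : MeasurableSet (f '' S) := hfe.measurableSet_image.2 hS
  have hcomp : ∀ n : ℕ, ∃ K ⊆ f '' S, IsCompact K ∧ P.map f (f '' S \ K) < (n + 1 : ℝ≥0∞)⁻¹ := by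
    intro n
    refine hT.exists_isCompact_sdiff_lt (measure_ne_top _ _) ?_
    exact ENNReal.inv_ne_zero.2 (by simp)
  choose K hKS hKc hKlt using hcomp
  choose u hum hu using fun n => (hKc n).exists_measurable_fiber_section
  obtain ⟨v, hvm, hv⟩ := he.exists_measurable_extend measurable_id fun _ => ‹Nonempty E›
  have hv' : ∀ x, v (embeddingReal E x) = x := fun x => congrFun hv x
  have hpm : ∀ n, MeasurableSet (Prod.fst '' K n) := fun n =>
    ((hKc n).image continuous_fst).isClosed.measurableSet
  -- The second alternative only makes `Nat.find` total; `M x` falls under it for almost no `x`.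
  have hex : ∀ m : ℝ, ∃ n, m ∈ Prod.fst '' K n ∨ ∀ k, m ∉ Prod.fst '' K k := by
    intro m
    by_cases h : ∃ n, m ∈ Prod.fst '' K n
    · obtain ⟨n, hn⟩ := h
      exact ⟨n, .inl hn⟩
    · exact ⟨0, .inr fun k hk => h ⟨k, hk⟩⟩
  refine ⟨fun m => v (u (Nat.find (hex m)) m), ?_, ?_⟩
  · refine hvm.comp (Measurable.find hum (fun n => ?_) hex)
    have := (hpm n).union (MeasurableSet.iInter fun k => (hpm k).compl)
    convert this using 1
    ext m
    simp
  have hnull : P {x | ∀ n, f x ∉ K n} = 0 := by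
    have hle : ∀ n : ℕ, P {x | ∀ n, f x ∉ K n} ≤ (n + 1 : ℝ≥0∞)⁻¹ := by
      intro n
      have hsub : {x | ∀ n, f x ∉ K n} ⊆ Sᶜ ∪ f ⁻¹' (f '' S \ K n) := by
        intro x hx
        by_cases hxS : x ∈ S
        · exact .inr ⟨⟨x, hxS, rfl⟩, hx n⟩
        · exact .inl hxS
      calc P {x | ∀ n, f x ∉ K n} ≤ P (Sᶜ ∪ f ⁻¹' (f '' S \ K n)) := measure_mono hsub
        _ ≤ P Sᶜ + P (f ⁻¹' (f '' S \ K n)) := measure_union_le _ _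
        _ = P.map f (f '' S \ K n) := by
          rw [hPS, zero_add, Measure.map_apply hfm (hT.diff (hKc n).measurableSet)]
        _ ≤ _ := (hKlt n).le
    refine le_antisymm (ge_of_tendsto' (f := fun n : ℕ => ((n + 1 : ℕ) : ℝ≥0∞)⁻¹) (x := .atTop) ?_
      fun n => by simpa using hle n) zero_le
    exact (Filter.tendsto_add_atTop_iff_nat (f := fun n : ℕ => (n : ℝ≥0∞)⁻¹) 1).2
      ENNReal.tendsto_inv_nat_nhds_zero
  have hae : ∀ᵐ x ∂P, ¬ ∀ n, f x ∉ K n := by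
    rw [ae_iff]
    simpa using hnull
  filter_upwards [hae] with x hx
  have hxn : M x ∈ Prod.fst '' K (Nat.find (hex (M x))) := by
    rcases Nat.find_spec (hex (M x)) with h | h
    · exact h
    · exact absurd (fun n hn => h n ⟨_, hn, rfl⟩) hx
  obtain ⟨y, hyS, hy⟩ := hKS _ (hu _ _ hxn)
  obtain ⟨hy1, hy2⟩ := Prod.ext_iff.1 hy
  dsimp only [hf] at hy1 hy2
  rw [← hy2, hv']
  exact ⟨hy1, hyS⟩

/-- A random element that is a function of another one, outside a null set, is a Borel function of
it almost surely. -/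
theorem exists_measurable_ae_factor {E N Z : Type*} [MeasurableSpace E] [StandardBorelSpace E]
    [MeasurableSpace N] [StandardBorelSpace N] [MeasurableSpace Z] [StandardBorelSpace Z]
    [Nonempty Z] {P : Measure E} {M : E → N} {γ : E → Z} (hM : AEMeasurable M P)
    (hγ : AEMeasurable γ P) {S : Set E} (hS : P Sᶜ = 0)
    (h : ∀ x ∈ S, ∀ x' ∈ S, M x = M x' → γ x = γ x') :
    ∃ s : N → Z, Measurable s ∧ ∀ᵐ x ∂P, γ x = s (M x) := by
  have hSae : ∀ᵐ x ∂P, x ∈ S := hS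
  obtain ⟨S', hS'm, hPS', hS'⟩ := exists_measurableSet_of_ae
    (hSae.and (hM.ae_eq_mk.and hγ.ae_eq_mk))
  have := hS'm.standardBorel
  set M₁ : S' → N := fun x => hM.mk M x with hM₁
  set γ₁ : S' → Z := fun x => hγ.mk γ x with hγ₁
  have hM₁m : Measurable M₁ := hM.measurable_mk.comp measurable_subtype_coe
  have hγ₁m : Measurable γ₁ := hγ.measurable_mk.comp measurable_subtype_coe
  have hfac : ∀ x x', M₁ x = M₁ x' → γ₁ x = γ₁ x' := by
    intro x x' hxx
    obtain ⟨h1, h2, h3⟩ := hS' x x.2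
    obtain ⟨h1', h2', h3'⟩ := hS' x' x'.2
    simp only [hγ₁, ← h3, ← h3']
    simp only [hM₁, ← h2, ← h2'] at hxx
    exact h _ h1 _ h1' hxx
  -- The images under `M₁` of `γ₁ ⁻¹' A` and of its complement are disjoint analytic sets; a Borel
  -- set `C` separating them has preimage `γ₁ ⁻¹' A`. Doob–Dynkin factorization then applies.
  have hmeas : Measurable[MeasurableSpace.comap M₁ inferInstance] γ₁ := by
    intro A hA
    let _ := upgradeStandardBorel N
    have hB : MeasurableSet (γ₁ ⁻¹' A) := hγ₁m hA
    have hdis : Disjoint (M₁ '' (γ₁ ⁻¹' A)) (M₁ '' (γ₁ ⁻¹' A)ᶜ) := by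
      rw [Set.disjoint_left]
      rintro _ ⟨x, hx, rfl⟩ ⟨x', hx', hxx⟩
      apply hx'
      rw [Set.mem_preimage, hfac _ _ hxx]
      exact hx
    obtain ⟨C, hC1, hC2, hC⟩ := (hB.analyticSet_image hM₁m).measurablySeparable
      (hB.compl.analyticSet_image hM₁m) hdis
    refine ⟨C, hC, Set.Subset.antisymm (fun x hx => ?_) fun x hx => hC1 ⟨x, hx, rfl⟩⟩
    by_contra hn
    exact Set.disjoint_left.1 hC2 ⟨x, hn, rfl⟩ hx
  obtain ⟨s, hs, hsc⟩ := hmeas.exists_eq_measurable_comp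
  refine ⟨s, hs, ?_⟩
  have hS'ae : ∀ᵐ x ∂P, x ∈ S' := hPS'
  filter_upwards [hS'ae] with x hx
  obtain ⟨-, h2, h3⟩ := hS' x hx
  rw [h3, h2]
  exact congrFun hsc ⟨x, hx⟩

/-! ### Inverting the orbit maps by disintegration -/

section InversionKernel

variable {G E : Type*} [Group G] [MeasurableSpace G] [StandardBorelSpace G]
  [MeasurableMul₂ G] [MeasurableInv G]
  [MeasurableSpace E] [StandardBorelSpace E] [MulAction G E] [MeasurableSMul₂ G E]

/-- A Borel kernel that inverts the orbit maps: `Z (s, x)` lives on the elements that take `s`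
to `x`, and depends equivariantly on `x`. -/
theorem exists_orbit_inversion_kernel (W : Kernel E G) [IsMarkovKernel W]
    (hW : ∀ (k : G) (x : E), W (k • x) = (W x).map (fun g => g * k⁻¹)) :
    ∃ Z : Kernel (E × E) G, IsMarkovKernel Z ∧
      (∀ s x (k : G), Z (s, k • x) = (Z (s, x)).map (fun t => k * t)) ∧
      ∀ s x, x ∈ MulAction.orbit G s → ∀ᵐ t ∂Z (s, x), t • s = x := by
  have hsm : ∀ x : E, Measurable fun g : G => g • x := fun x => measurable_smul_const x
  have hgm : ∀ s : E, Measurable fun g : G => (g • s, g) := fun s => (hsm s).prodMk measurable_id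
  have hJm : Measurable fun p : E × G => (p.2 • p.1, p.2) :=
    (measurable_snd.smul measurable_fst).prodMk measurable_snd
  let J : Kernel E (E × G) := (Kernel.id ×ₖ W).map fun p => (p.2 • p.1, p.2)
  have hJ : ∀ s, J s = (W s).map fun g => (g • s, g) := by
    intro s
    simp only [J]
    rw [Kernel.map_apply _ hJm, Kernel.prod_apply, Kernel.id_apply, Measure.dirac_prod,
      Measure.map_map hJm measurable_prodMk_left]
    rfl
  have : IsMarkovKernel J := Kernel.IsMarkovKernel.map _ hJm
  -- The conditional law of `g` given `g • s`, for `g` drawn from `W s`. It inverts the orbit map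
  -- only at almost every point of the orbit.
  set κ := J.condKernel with hκ
  have hconc : ∀ s, ∀ᵐ g ∂W s, ∀ᵐ t ∂κ (s, g • s), t • s = g • s := by
    intro s
    have h1 : ∀ᵐ p ∂J s, p.2 • s = p.1 := by
      rw [hJ, ae_map_iff (hgm s).aemeasurable]
      · simp
      · exact measurableSet_eq_fun ((hsm s).comp measurable_snd) measurable_fst
    rw [← J.disintegrate κ] at h1
    have h2 := Kernel.ae_ae_of_ae_compProd h1
    rw [Kernel.fst_apply, hJ, Measure.map_map measurable_fst (hgm s)] at h2
    exact ae_of_ae_map (hsm s).aemeasurable h2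
  have hcm : Measurable fun p : (E × E) × G => (p.1.1, p.2 • p.1.2) := by fun_prop
  have hdm : Measurable fun p : G × G => p.1⁻¹ * p.2 := by fun_prop
  -- Draw `g` from `W x`, then `t` from `κ (s, g • x)`, and return `g⁻¹ * t`. The averaging turns
  -- the almost-everywhere property of `κ` into one valid at every `x` of the orbit of `s`, and the
  -- right shift of `W` into left equivariance.
  let Z : Kernel (E × E) G :=
    (W.comap Prod.snd measurable_snd ⊗ₖ κ.comap _ hcm).map fun p => p.1⁻¹ * p.2
  have hZ : ∀ s x (u : G → ℝ≥0∞), Measurable u →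
      ∫⁻ t, u t ∂Z (s, x) = ∫⁻ g, ∫⁻ t, u (g⁻¹ * t) ∂κ (s, g • x) ∂W x := by
    intro s x u hu
    rw [Kernel.lintegral_map _ hdm _ hu]
    exact Kernel.lintegral_compProd _ _ _ (hu.comp hdm)
  have hκm : ∀ s x (u : G → ℝ≥0∞), Measurable u →
      Measurable fun g => ∫⁻ t, u (g⁻¹ * t) ∂κ (s, g • x) := by
    intro s x u hu
    have := Measurable.lintegral_kernel_prod_right'
      (κ := κ.comap (fun g : G => (s, g • x)) (measurable_const.prodMk (hsm x))) (hu.comp hdm)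
    exact this
  refine ⟨Z, Kernel.IsMarkovKernel.map _ hdm, fun s x k => ?_, fun s x hx => ?_⟩
  · refine Measure.ext_of_lintegral _ fun u hu => ?_
    rw [lintegral_map hu (measurable_const_mul k), hZ _ _ _ hu,
      hZ s x (fun t => u (k * t)) (hu.comp (measurable_const_mul k)), hW,
      lintegral_map (hκm s (k • x) u hu) (measurable_mul_const _)]
    simp [← mul_smul, mul_assoc]
  · obtain ⟨k, rfl⟩ := hx
    have hset : MeasurableSet {t : G | t • s = k • s} := hsm s (measurableSet_singleton _)
    simp only [Z]
    rw [Kernel.map_apply _ hdm, ae_map_iff hdm.aemeasurable hset]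
    refine Kernel.ae_compProd_of_ae_ae (hdm hset) ?_
    simp only [Kernel.comap_apply, hW]
    rw [(measurableEmbedding_mulRight k⁻¹).ae_map_iff]
    filter_upwards [hconc s] with g hg
    simp only [← mul_smul, inv_mul_cancel_right]
    filter_upwards [hg] with t ht
    simp [mul_smul, ht]

end InversionKernel

/-! ### From almost everywhere to everywhere equivariant kernels -/

section EquivariantKernels

variable {G E F : Type*} [Group G] [MeasurableSpace G]
  [MeasurableSpace E] [MulAction G E]
  [MeasurableSpace F] [MulAction G F] [MeasurableSMul₂ G F]

theorem forall_smul_set_eq_iff_forall_map_smul (Q : Kernel E F) :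
    (∀ (g : G) (x : E) (B : Set F), MeasurableSet B → Q x B = Q (g • x) (g • B)) ↔
      ∀ (g : G) (x : E), Q (g • x) = (Q x).map (fun y => g • y) := by
  constructor
  · intro h g x
    ext B hB
    rw [Measure.map_apply (measurable_const_smul g) hB, Set.preimage_smul,
      h g x _ (hB.const_smul g⁻¹), smul_inv_smul]
  · intro h g x B hB
    rw [h, Measure.map_apply (measurable_const_smul g) (hB.const_smul g), Set.preimage_smul,
      inv_smul_smul]

variable [StandardBorelSpace G] [MeasurableMul₂ G] [MeasurableInv G] [StandardBorelSpace E]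
  [MeasurableSMul₂ G E]

/-- A Markov kernel that is equivariant on a set of full measure agrees almost everywhere with an
everywhere equivariant one. -/
theorem exists_equivariant_kernel_ae_eq (W : Kernel E G) [IsMarkovKernel W]
    (hW : ∀ (k : G) (x : E), W (k • x) = (W x).map (fun g => g * k⁻¹))
    (P : Measure E) [IsProbabilityMeasure P] (q : Kernel E F) [IsMarkovKernel q]
    {S : Set E} (hS : MeasurableSet S) (hPS : P Sᶜ = 0)
    (hq : ∀ x ∈ S, ∀ g : G, g • x ∈ S → q (g • x) = (q x).map (fun y => g • y)) :
    ∃ Q : Kernel E F, IsMarkovKernel Q ∧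
      (∀ (g : G) (x : E), Q (g • x) = (Q x).map (fun y => g • y)) ∧ Q =ᵐ[P] q := by
  have : Nonempty E := P.nonempty_of_neZero
  obtain ⟨M, hMm, hM⟩ := exists_measurable_orbit_invariant W hW
  obtain ⟨Z, hZ, hZe, hZs⟩ := exists_orbit_inversion_kernel W hW
  obtain ⟨s, hs, hsae⟩ := exists_measurable_ae_section P hMm hS hPS
  have hγ : Measurable fun x => s (M x) := hs.comp hMm
  have hsmul : Measurable fun p : G × F => p.1 • p.2 := measurable_fst.smul measurable_snd
  -- Only the values of `q` at the representatives `s (M x)` are kept, and `Z` transports them along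
  -- the orbit. Almost every representative lies in `S`, where equivariance of `q` recovers `q x`.
  let Q : Kernel E F := (Z.comap (fun x => (s (M x), x)) (hγ.prodMk measurable_id) ×ₖ
    q.comap (fun x => s (M x)) hγ).map fun p => p.1 • p.2
  have hQ : ∀ x (u : F → ℝ≥0∞), Measurable u →
      ∫⁻ y, u y ∂Q x = ∫⁻ t, ∫⁻ y, u (t • y) ∂q (s (M x)) ∂Z (s (M x), x) := by
    intro x u hu
    rw [Kernel.lintegral_map _ hsmul _ hu]
    exact Kernel.lintegral_prod _ _ _ (hu.comp hsmul)
  refine ⟨Q, Kernel.IsMarkovKernel.map _ hsmul, fun g x => ?_, ?_⟩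
  · refine Measure.ext_of_lintegral _ fun u hu => ?_
    have hMg : M (g • x) = M x := (hM _ _).2 (MulAction.mem_orbit x g)
    have hum : Measurable fun t : G => ∫⁻ y, u (t • y) ∂q (s (M x)) :=
      Measurable.lintegral_prod_right' (hu.comp hsmul)
    rw [lintegral_map hu (measurable_const_smul g),
      hQ x (fun y => u (g • y)) (hu.comp (measurable_const_smul g)), hQ _ _ hu, hMg, hZe,
      lintegral_map hum (measurable_const_mul g)]
    simp only [mul_smul]
  · have hSae : ∀ᵐ x ∂P, x ∈ S := hPS
    filter_upwards [hsae, hSae] with x hx hxS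
    refine Measure.ext_of_lintegral _ fun u hu => ?_
    rw [hQ x u hu]
    have horb : x ∈ MulAction.orbit G (s (M x)) := (hM _ _).1 hx.1.symm
    calc ∫⁻ t, ∫⁻ y, u (t • y) ∂q (s (M x)) ∂Z (s (M x), x)
        = ∫⁻ t, ∫⁻ y, u y ∂q x ∂Z (s (M x), x) := by
          refine lintegral_congr_ae ?_
          filter_upwards [hZs _ _ horb] with t ht
          have := hq _ hx.2 t (by rwa [ht])
          rw [ht] at this
          rw [this, lintegral_map hu (measurable_const_smul t)]
      _ = ∫⁻ y, u y ∂q x := by simp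

end EquivariantKernels

/-! ### Existence of orbit selectors and inversion kernels -/

section Existence

variable {G E : Type*} [Group G] [TopologicalSpace G] [IsTopologicalGroup G]
  [SecondCountableTopology G] [MeasurableSpace G] [BorelSpace G]

/-- A probability measure on `G` that is carried by a subgroup and invariant under it is its
normalized Haar measure. -/
theorem isNormalizedHaarOf_of_map_mul_eq {H : Subgroup G} (hH : MeasurableSet (H : Set G))
    {ν : Measure G} [IsProbabilityMeasure ν] (hν : ∀ᵐ t ∂ν, t ∈ H)
    (hinv : ∀ k ∈ H, ν.map (fun t => k * t) = ν) : IsNormalizedHaarOf H ν := by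
  have he : MeasurableEmbedding (Subtype.val : H → G) := MeasurableEmbedding.subtype_coe hH
  set η : Measure H := ν.comap Subtype.val with hη
  have hmap : η.map Subtype.val = ν := by
    rw [hη, he.map_comap, Measure.restrict_eq_self_of_ae_mem]
    simpa using hν
  have hprob : IsProbabilityMeasure η := by
    constructor
    rw [← Set.preimage_univ (f := (Subtype.val : H → G)),
      ← Measure.map_apply he.measurable MeasurableSet.univ, hmap, measure_univ]
  have hleft : η.IsMulLeftInvariant := by
    constructor
    intro k
    have h1 : (η.map (fun t => k * t)).map Subtype.val = η.map Subtype.val := by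
      rw [Measure.map_map he.measurable (measurable_const_mul k)]
      have : Subtype.val ∘ (fun t : H => k * t) = (fun t : G => k * t) ∘ Subtype.val := by
        ext t
        simp
      rw [this, ← Measure.map_map (measurable_const_mul _) he.measurable, hmap, hinv k k.2]
    rw [← he.comap_map (η.map (fun t => k * t)), h1, he.comap_map]
  have hopen : η.IsOpenPosMeasure := by
    constructor
    rintro U hU ⟨u, hu⟩ h0
    have : SecondCountableTopology H := TopologicalSpace.Subtype.secondCountableTopology _
    -- Countably many translates of `U` cover `H`, so a null `U` would make `η` vanish.
    obtain ⟨T, hTc, hT⟩ := TopologicalSpace.isOpen_iUnion_countable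
      (fun k : H => (fun t => k * t) ⁻¹' U) fun k => hU.preimage (continuous_const_mul k)
    have huniv : (⋃ k : H, (fun t => k * t) ⁻¹' U) = Set.univ :=
      Set.eq_univ_of_forall fun t => Set.mem_iUnion.2 ⟨u * t⁻¹, by simpa using hu⟩
    have : η Set.univ = 0 := by
      rw [← huniv, ← hT, measure_biUnion_null_iff hTc]
      intro k _
      rw [measure_preimage_mul, h0]
    simp at this
  exact ⟨η, {}, hprob, hmap.symm⟩

variable [LocallyCompactSpace G] [T2Space G] [MeasurableSpace E] [StandardBorelSpace E]
  [MulAction G E] [MeasurableSMul₂ G E]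

/-- A proper action has an orbit selector and an associated inversion kernel, both measurable up to
null sets of a given probability measure. -/
theorem IsProperAction.exists_inversionKernel (hp : IsProperAction G E) (P : Measure E)
    [IsProbabilityMeasure P] :
    ∃ (γ : E → E) (ζ : E → Measure G), AEMeasurable γ P ∧ AEMeasurable ζ P ∧
      IsOrbitSelectorOn G Set.univ γ ∧ IsInversionKernelOn Set.univ γ ζ := by
  classical
  have : PolishSpace G := polishSpace_of_locallyCompact_group G
  have : Nonempty E := P.nonempty_of_neZero
  obtain ⟨W, _, hW⟩ := hp.exists_equivariant_kernel
  obtain ⟨M, hMm, hM⟩ := exists_measurable_orbit_invariant W hW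
  obtain ⟨Z, hZ, hZe, hZs⟩ := exists_orbit_inversion_kernel W hW
  obtain ⟨s, hs, hsae⟩ := exists_measurable_ae_section P hMm MeasurableSet.univ (by simp)
  have hsm : Measurable fun x => s (M x) := hs.comp hMm
  let r : E → E := fun x => (Quotient.mk (MulAction.orbitRel G E) x).out
  have hr : ∀ x, r x ∈ MulAction.orbit G x := fun x =>
    Quotient.exact (s := MulAction.orbitRel G E) (Quotient.out_eq _)
  have hrr : ∀ x x', x ∈ MulAction.orbit G x' → r x = r x' := by
    intro x x' h
    have : (Quotient.mk (MulAction.orbitRel G E) x) = Quotient.mk _ x' := Quotient.sound h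
    simp only [r, this]
  -- The case distinction depends only on `M x`, so `γ` stays constant on orbits. The arbitrary
  -- choice `r` is used only on a null set, which keeps `γ` almost everywhere measurable and leaves
  -- no exceptional points.
  let γ : E → E := fun x => if M (s (M x)) = M x then s (M x) else r x
  have hγo : ∀ x, γ x ∈ MulAction.orbit G x := by
    intro x
    by_cases h : M (s (M x)) = M x
    · simpa only [γ, if_pos h] using (hM _ _).1 h
    · simpa only [γ, if_neg h] using hr x
  have hγc : ∀ x x', x ∈ MulAction.orbit G x' → γ x = γ x' := by
    intro x x' h
    simp only [γ, (hM _ _).2 h, hrr _ _ h]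
  have hγae : γ =ᵐ[P] fun x => s (M x) := by
    filter_upwards [hsae] with x hx
    simp only [γ, if_pos hx.1]
  refine ⟨γ, fun x => Z (γ x, x), ⟨_, hsm, hγae⟩,
    ⟨_, Z.measurable.comp (hsm.prodMk measurable_id), ?_⟩,
    ⟨fun x _ => hγo x, fun x _ x' _ => hγc x x'⟩, ⟨fun x _ => inferInstance, ?_, ?_, ?_⟩⟩
  · filter_upwards [hγae] with x hx
    simp [hx]
  · intro x _ g B hB
    rw [hγc (g • x) x (MulAction.mem_orbit x g), hZe,
      Measure.map_apply (measurable_const_mul g) hB, ← Set.preimage_smul]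
    rfl
  · intro x _
    rw [hγc (γ x) x (hγo x)]
    refine isNormalizedHaarOf_of_map_mul_eq ?_ (hZs _ _ (MulAction.mem_orbit_self _)) ?_
    · exact (measurable_smul_const (γ x)) (measurableSet_singleton (γ x))
    · intro k hk
      rw [← hZe, MulAction.mem_stabilizer_iff.1 hk]
  · intro x _
    exact hZs _ _ (MulAction.mem_orbit_symm.1 (hγo x))

end Existence

/-! ### Conditional independence given a function of one variable -/

section ConditionalIndependence

variable {A B C Ω : Type*} [MeasurableSpace A] [MeasurableSpace B] [MeasurableSpace C]
  [MeasurableSpace Ω]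

/-- Integrating over `B` innermost leaves `κ` only inside `ρ ⊗ₘ κ`, the joint law of the
conditioning variable and the first component. -/
theorem lintegral_compProd_prod (ρ : Measure C) [SFinite ρ] (κ : Kernel C A) [IsMarkovKernel κ]
    (η : Kernel C B) [IsMarkovKernel η] {u : C × A × B → ℝ≥0∞} (hu : Measurable u) :
    ∫⁻ p, u p ∂(ρ ⊗ₘ (κ ×ₖ η)) = ∫⁻ p, ∫⁻ b, u (p.1, p.2, b) ∂η p.1 ∂(ρ ⊗ₘ κ) := by
  have hv : Measurable fun p : C × A => ∫⁻ b, u (p.1, p.2, b) ∂η p.1 := by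
    have : Measurable fun p : (C × A) × B => u (p.1.1, p.1.2, p.2) := by fun_prop
    exact Measurable.lintegral_kernel_prod_right' (κ := η.comap Prod.fst measurable_fst) this
  rw [Measure.lintegral_compProd hu, Measure.lintegral_compProd hv]
  refine lintegral_congr fun c => ?_
  exact Kernel.lintegral_prod _ _ _ (hu.comp measurable_prodMk_left)

/-- If `W` is a function of `U`, then `U` and `V` are conditionally independent given `W` exactly
when the conditional distribution of `V` given `U` depends only on `W`. -/
theorem condIndepGiven_iff_exists_kernel [StandardBorelSpace A] {μ : Measure Ω}
    [IsProbabilityMeasure μ] {U : Ω → A} {V : Ω → B} {W : Ω → C} (hU : AEMeasurable U μ)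
    (hV : AEMeasurable V μ) {f : A → C} (hf : Measurable f) (hW : W =ᵐ[μ] fun ω => f (U ω)) :
    CondIndepGiven μ U V W ↔ ∃ η : Kernel C B, IsMarkovKernel η ∧
      μ.map (fun ω => (U ω, V ω)) = μ.map U ⊗ₘ η.comap f hf := by
  have hνp : IsProbabilityMeasure (μ.map U) := Measure.isProbabilityMeasure_map hU
  have : Nonempty A := (μ.map U).nonempty_of_neZero
  set ν := μ.map U with hν
  have hjm : Measurable fun p : A × B => (f p.1, p.1, p.2) := by fun_prop
  have hfid : Measurable fun a : A => (f a, a) := hf.prodMk measurable_id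
  have hWν : μ.map W = ν.map f := by
    rw [Measure.map_congr hW, hν, AEMeasurable.map_map_of_aemeasurable hf.aemeasurable hU]
    rfl
  have hνf : IsProbabilityMeasure (ν.map f) := Measure.isProbabilityMeasure_map hf.aemeasurable
  have hlaw : μ.map (fun ω => (W ω, U ω, V ω)) =
      (μ.map fun ω => (U ω, V ω)).map fun p => (f p.1, p.1, p.2) := by
    rw [AEMeasurable.map_map_of_aemeasurable hjm.aemeasurable (hU.prodMk hV)]
    refine Measure.map_congr ?_
    filter_upwards [hW] with ω hω
    simp [hω]
  have hvm : ∀ (η : Kernel C B) [IsMarkovKernel η] (u : C × A × B → ℝ≥0∞), Measurable u →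
      Measurable fun p : C × A => ∫⁻ b, u (p.1, p.2, b) ∂η p.1 := by
    intro η _ u hu
    have : Measurable fun p : (C × A) × B => u (p.1.1, p.1.2, p.2) := by fun_prop
    exact Measurable.lintegral_kernel_prod_right' (κ := η.comap Prod.fst measurable_fst) this
  rw [CondIndepGiven, hlaw, hWν]
  constructor
  · rintro ⟨κ, η, hκ, hη, h⟩
    refine ⟨η, hη, Measure.ext_of_lintegral _ fun u hu => ?_⟩
    -- The marginal on `C × A` is the law of `(f U, U)`, so averaging over `κ` amounts to evaluating
    -- at `f U`.
    have hmarg : ν.map f ⊗ₘ κ = ν.map fun a => (f a, a) := by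
      have hpm : Measurable fun p : C × A × B => (p.1, p.2.1) := by fun_prop
      have h1 : (ν.map f ⊗ₘ (κ ×ₖ η)).map (fun p => (p.1, p.2.1)) = ν.map f ⊗ₘ κ := by
        refine Measure.ext_of_lintegral _ fun v hv => ?_
        rw [lintegral_map hv hpm]
        refine (lintegral_compProd_prod _ _ _ (hv.comp hpm)).trans ?_
        simp
      rw [← h1, ← h, Measure.map_map hpm hjm, hν,
        AEMeasurable.map_map_of_aemeasurable hfid.aemeasurable hU,
        AEMeasurable.map_map_of_aemeasurable (hpm.comp hjm).aemeasurable (hU.prodMk hV)]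
      rfl
    have hu' : Measurable fun p : C × A × B => u p.2 := hu.comp measurable_snd
    have h2 : ∫⁻ p, u p ∂(μ.map fun ω => (U ω, V ω)) =
        ∫⁻ p, u p.2 ∂((μ.map fun ω => (U ω, V ω)).map fun p => (f p.1, p.1, p.2)) := by
      rw [lintegral_map hu' hjm]
    rw [h2, h, lintegral_compProd_prod _ _ _ hu', hmarg, lintegral_map (hvm η _ hu') hfid,
      Measure.lintegral_compProd hu]
    rfl
  · rintro ⟨η, hη, h⟩
    refine ⟨condDistrib id f ν, η, inferInstance, hη, Measure.ext_of_lintegral _ fun u hu => ?_⟩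
    have hcond : ν.map f ⊗ₘ condDistrib id f ν = ν.map fun a => (f a, a) :=
      compProd_map_condDistrib aemeasurable_id
    rw [lintegral_compProd_prod _ _ _ hu, hcond, lintegral_map (hvm η u hu) hfid, h, lintegral_map hu hjm]
    exact Measure.lintegral_compProd (hu.comp hjm)

end ConditionalIndependence

/-! ### Equivariance through the law of `T⁻¹ Y` -/

section Characterization

variable {G E F N Ω : Type*} [Group G] [MeasurableSpace G] [StandardBorelSpace G]
  [MeasurableMul₂ G] [MeasurableInv G]
  [MeasurableSpace E] [StandardBorelSpace E] [MulAction G E] [MeasurableSMul₂ G E]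
  [MeasurableSpace F] [MulAction G F] [MeasurableSMul₂ G F]
  [MeasurableSpace N] [MeasurableSpace Ω]
  {μ : Measure Ω} [IsProbabilityMeasure μ] {X : Ω → E} {Y : Ω → F}

/-- Changing the kernel on a null set of `X` preserves the joint law, so equivariance on a set of
full measure can be repaired. -/
theorem condDistribEquivariant_of_equivariant_on (W : Kernel E G) [IsMarkovKernel W]
    (hW : ∀ (k : G) (x : E), W (k • x) = (W x).map (fun g => g * k⁻¹)) (hX : Measurable X)
    (q : Kernel E F) [IsMarkovKernel q] (hlaw : μ.map (fun ω => (X ω, Y ω)) = μ.map X ⊗ₘ q)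
    {S : Set E} (hS : MeasurableSet S) (hPS : μ.map X Sᶜ = 0)
    (hq : ∀ x ∈ S, ∀ g : G, g • x ∈ S → q (g • x) = (q x).map (fun y => g • y)) :
    CondDistribEquivariant G μ X Y := by
  have := Measure.isProbabilityMeasure_map (μ := μ) hX.aemeasurable
  obtain ⟨Q, hQ, hQe, hQq⟩ := exists_equivariant_kernel_ae_eq W hW (μ.map X) q hS hPS hq
  exact ⟨Q, hQ, hlaw.trans (Measure.compProd_congr hQq.symm),
    (forall_smul_set_eq_iff_forall_map_smul Q).2 hQe⟩

/-- If `T` is drawn from a kernel that inverts the action, equivariance of the conditional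
distribution of `Y` given `X` means that the conditional distribution of `T⁻¹ Y` given `(T, X)`
depends on `X` only through the maximal invariant. -/
theorem condDistribEquivariant_iff_exists_kernel [StandardBorelSpace N] (W : Kernel E G)
    [IsMarkovKernel W]
    (hW : ∀ (k : G) (x : E), W (k • x) = (W x).map (fun g => g * k⁻¹)) (hX : Measurable X)
    (hY : Measurable Y) {T : Ω → G} (hT : AEMeasurable T μ) (ζ : Kernel E G) [IsMarkovKernel ζ]
    (hTlaw : μ.map (fun ω => ((X ω, Y ω), T ω)) =
      μ.map (fun ω => (X ω, Y ω)) ⊗ₘ ζ.comap Prod.fst measurable_fst)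
    {S : Set E} (hS : MeasurableSet S) (hPS : μ.map X Sᶜ = 0) {M : E → N} (hM : Measurable M)
    (hMS : IsMaximalInvariantOn G S M) {γ : E → E} (hγ : AEMeasurable γ (μ.map X))
    (hγS : IsOrbitSelectorOn G S γ) (hinv : ∀ x ∈ S, ∀ᵐ t ∂ζ x, t • γ x = x)
    (hζ : ∀ x ∈ S, ∀ g : G, g • x ∈ S → ζ (g • x) = (ζ x).map (fun t => g * t)) :
    CondDistribEquivariant G μ X Y ↔ ∃ η : Kernel N F, IsMarkovKernel η ∧
      μ.map (fun ω => ((T ω, X ω), (T ω)⁻¹ • Y ω)) =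
        μ.map (fun ω => (T ω, X ω)) ⊗ₘ
          η.comap (fun p : G × E => M p.2) (hM.comp measurable_snd) := by
  have hXYm : Measurable fun ω => (X ω, Y ω) := hX.prodMk hY
  have hP := Measure.isProbabilityMeasure_map (μ := μ) hX.aemeasurable
  have hPXY := Measure.isProbabilityMeasure_map (μ := μ) hXYm.aemeasurable
  have hTX : AEMeasurable (fun ω => (T ω, X ω)) μ := hT.prodMk hX.aemeasurable
  have hPTX := Measure.isProbabilityMeasure_map hTX
  have hXYT : AEMeasurable (fun ω => ((X ω, Y ω), T ω)) μ := hXYm.aemeasurable.prodMk hT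
  have hTXV : AEMeasurable (fun ω => ((T ω, X ω), (T ω)⁻¹ • Y ω)) μ :=
    hTX.prodMk (hT.inv.smul hY.aemeasurable)
  have hexp : ∀ u : (E × F) × G → ℝ≥0∞, Measurable u →
      ∫⁻ ω, u ((X ω, Y ω), T ω) ∂μ =
        ∫⁻ p, ∫⁻ t, u (p, t) ∂ζ p.1 ∂μ.map (fun ω => (X ω, Y ω)) := by
    intro u hu
    rw [← lintegral_map' hu.aemeasurable hXYT, hTlaw, Measure.lintegral_compProd hu]
    rfl
  have hexpTX : ∀ v : G × E → ℝ≥0∞, Measurable v →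
      ∫⁻ p, v p ∂μ.map (fun ω => (T ω, X ω)) = ∫⁻ x, ∫⁻ t, v (t, x) ∂ζ x ∂μ.map X := by
    intro v hv
    have h1 : Measurable fun p : (E × F) × G => v (p.2, p.1.1) := by fun_prop
    have h2 : Measurable fun x => ∫⁻ t, v (t, x) ∂ζ x := by
      have : Measurable fun p : E × G => v (p.2, p.1) := by fun_prop
      exact this.lintegral_kernel_prod_right'
    rw [lintegral_map' hv.aemeasurable hTX, hexp _ h1, lintegral_map h2 hX]
    exact lintegral_map (h2.comp measurable_fst) hXYm
  have hSae : ∀ᵐ x ∂μ.map X, x ∈ S := hPS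
  constructor
  · rintro ⟨Q, hQ, hQlaw, hQe⟩
    rw [forall_smul_set_eq_iff_forall_map_smul] at hQe
    have : Nonempty E := (μ.map X).nonempty_of_neZero
    obtain ⟨s, hs, hsae⟩ := exists_measurable_ae_factor hM.aemeasurable hγ hPS
      fun x hx x' hx' h => hγS.2 x hx x' hx' ((hMS x hx x' hx').1 h)
    refine ⟨Q.comap s hs, inferInstance, Measure.ext_of_lintegral _ fun u hu => ?_⟩
    have h1 : Measurable fun p : (E × F) × G => u ((p.2, p.1.1), p.2⁻¹ • p.1.2) := by fun_prop
    have h2 : Measurable fun p : G × E => ∫⁻ y, u (p, y) ∂Q (s (M p.2)) :=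
      Measurable.lintegral_kernel_prod_right'
        (κ := Q.comap (fun p : G × E => s (M p.2)) (hs.comp (hM.comp measurable_snd))) hu
    have h3 : Measurable fun p : E × F => ∫⁻ t, u ((t, p.1), t⁻¹ • p.2) ∂ζ p.1 :=
      Measurable.lintegral_kernel_prod_right' (κ := ζ.comap Prod.fst measurable_fst) h1
    rw [lintegral_map' hu.aemeasurable hTXV, hexp _ h1, hQlaw, Measure.lintegral_compProd h3,
      Measure.lintegral_compProd hu]
    refine Eq.trans ?_ (hexpTX _ h2).symm
    refine lintegral_congr_ae ?_
    filter_upwards [hSae, hsae] with x hxS hxs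
    have h4 : Measurable fun p : F × G => u ((p.2, x), p.2⁻¹ • p.1) := by fun_prop
    -- Given `X`, the elements `T` and `Y` are independent, so `t` may be fixed first; then `Q x` is
    -- the image of `Q (γ x)` under `t`.
    rw [lintegral_lintegral_swap h4.aemeasurable]
    refine lintegral_congr_ae ?_
    filter_upwards [hinv x hxS] with t ht
    have hQx : Q x = (Q (γ x)).map (fun y => t • y) := by rw [← hQe, ht]
    have h5 : Measurable fun y : F => u ((t, x), t⁻¹ • y) := by fun_prop
    rw [hQx, lintegral_map h5 (measurable_const_smul t), hxs]
    simp only [inv_smul_smul]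
  · rintro ⟨η, hη, hηlaw⟩
    have hsmul : Measurable fun p : G × F => p.1 • p.2 := measurable_fst.smul measurable_snd
    -- The law of `T (T⁻¹ Y)` given `X = x`, the factors being independent with laws `ζ x` and `η (M
    -- x)`.
    let q : Kernel E F := (ζ ×ₖ η.comap M hM).map fun p => p.1 • p.2
    have hqm : IsMarkovKernel q := Kernel.IsMarkovKernel.map _ hsmul
    have hq : ∀ x (u : F → ℝ≥0∞), Measurable u →
        ∫⁻ y, u y ∂q x = ∫⁻ t, ∫⁻ y, u (t • y) ∂η (M x) ∂ζ x := by
      intro x u hu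
      rw [Kernel.lintegral_map _ hsmul _ hu]
      exact Kernel.lintegral_prod _ _ _ (hu.comp hsmul)
    refine condDistribEquivariant_of_equivariant_on W hW hX q ?_ hS hPS fun x hx g hgx => ?_
    · refine Measure.ext_of_lintegral _ fun u hu => ?_
      have h1 : Measurable fun p : (G × E) × F => u (p.1.2, p.1.1 • p.2) := by fun_prop
      have h2 : Measurable fun p : G × E => ∫⁻ y, u (p.2, p.1 • y) ∂η (M p.2) :=
        Measurable.lintegral_kernel_prod_right'
          (κ := η.comap (fun p : G × E => M p.2) (hM.comp measurable_snd)) h1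
      rw [lintegral_map hu hXYm, Measure.lintegral_compProd hu]
      calc ∫⁻ ω, u (X ω, Y ω) ∂μ
          = ∫⁻ ω, u (X ω, T ω • (T ω)⁻¹ • Y ω) ∂μ := by simp
        _ = ∫⁻ p, u (p.1.2, p.1.1 • p.2) ∂μ.map (fun ω => ((T ω, X ω), (T ω)⁻¹ • Y ω)) :=
          (lintegral_map' h1.aemeasurable hTXV).symm
        _ = ∫⁻ p, ∫⁻ y, u (p.2, p.1 • y) ∂η (M p.2) ∂μ.map (fun ω => (T ω, X ω)) := by
          rw [hηlaw, Measure.lintegral_compProd h1]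
          rfl
        _ = ∫⁻ x, ∫⁻ y, u (x, y) ∂q x ∂μ.map X := by
          rw [hexpTX _ h2]
          exact lintegral_congr fun x => (hq x _ (hu.comp measurable_prodMk_left)).symm
    · refine Measure.ext_of_lintegral _ fun u hu => ?_
      have hMg : M (g • x) = M x := (hMS _ hgx _ hx).2 (MulAction.mem_orbit x g)
      have hum : Measurable fun t : G => ∫⁻ y, u (t • y) ∂η (M x) :=
        Measurable.lintegral_prod_right' (hu.comp hsmul)
      rw [lintegral_map hu (measurable_const_smul g),
        hq x (fun y => u (g • y)) (hu.comp (measurable_const_smul g)), hq _ _ hu, hMg,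
        hζ x hx g hgx, lintegral_map hum (measurable_const_mul g)]
      simp only [mul_smul]

end Characterization

/-! ### Passage to Borel versions and the main theorem -/

theorem IsMaximalInvariantOn.congr {G E N : Type*} [Group G] [MulAction G E] {S S' : Set E}
    {M M' : E → N} (h : IsMaximalInvariantOn G S M) (hS : S' ⊆ S) (hM : ∀ x ∈ S', M x = M' x) :
    IsMaximalInvariantOn G S' M' := by
  intro x hx x' hx'
  rw [← hM x hx, ← hM x' hx']
  exact h x (hS hx) x' (hS hx')

theorem IsOrbitSelectorOn.mono {G E : Type*} [Group G] [MulAction G E] {S S' : Set E}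
    {γ : E → E} (h : IsOrbitSelectorOn G S γ) (hS : S' ⊆ S) : IsOrbitSelectorOn G S' γ :=
  ⟨fun x hx => h.1 x (hS hx), fun x hx x' hx' => h.2 x (hS hx) x' (hS hx')⟩

/-- A family of probability measures that agrees on a measurable set with a measurable family
agrees there with a Markov kernel. -/
theorem exists_markovKernel_eq_on {E G : Type*} [MeasurableSpace E] [MeasurableSpace G] [Nonempty G]
    {ζ ζ' : E → Measure G} (hζ' : Measurable ζ') {S : Set E} (hS : MeasurableSet S)
    (heq : ∀ x ∈ S, ζ x = ζ' x) (hprob : ∀ x ∈ S, IsProbabilityMeasure (ζ x)) :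
    ∃ κ : Kernel E G, IsMarkovKernel κ ∧ ∀ x ∈ S, κ x = ζ x := by
  classical
  let κ : Kernel E G := ⟨fun x => if x ∈ S then ζ' x else Measure.dirac (Classical.arbitrary G),
    Measurable.ite hS hζ' measurable_const⟩
  have hκ : ∀ x ∈ S, κ x = ζ x := fun x hx => (if_pos hx).trans (heq x hx).symm
  refine ⟨κ, ⟨fun x => ?_⟩, hκ⟩
  by_cases hx : x ∈ S
  · rw [hκ x hx]
    exact hprob x hx
  · have : κ x = Measure.dirac (Classical.arbitrary G) := if_neg hx
    rw [this]
    infer_instance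

theorem IsDrawnFrom.map_eq_compProd {E F H Ω : Type*} [MeasurableSpace E] [MeasurableSpace F]
    [MeasurableSpace H] [MeasurableSpace Ω] {μ : Measure Ω} [IsProbabilityMeasure μ] {X : Ω → E}
    {Y : Ω → F} {ζ : E → Measure H} {T : Ω → H} (h : IsDrawnFrom μ X Y ζ T) (hX : Measurable X)
    (hY : Measurable Y) (hT : Measurable T) (κ : Kernel E H) [IsMarkovKernel κ]
    (hκ : ∀ᵐ x ∂μ.map X, κ x = ζ x) :
    μ.map (fun ω => ((X ω, Y ω), T ω)) =
      μ.map (fun ω => (X ω, Y ω)) ⊗ₘ κ.comap Prod.fst measurable_fst := by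
  have hXY : Measurable fun ω => (X ω, Y ω) := hX.prodMk hY
  have := Measure.isProbabilityMeasure_map (μ := μ) (hXY.prodMk hT).aemeasurable
  refine Measure.ext_prod fun {A B} hA hB => ?_
  rw [Measure.map_apply (hXY.prodMk hT) (hA.prod hB), Measure.compProd_apply_prod hA hB,
    setLIntegral_map hA (Kernel.measurable_coe _ hB) hXY]
  refine (h A B hA hB).trans (lintegral_congr_ae (ae_restrict_of_ae ?_))
  filter_upwards [ae_of_ae_map hX.aemeasurable hκ] with ω hω
  simp [hω]

theorem mainTheorem3 {G E F N Ω : Type*}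
    -- a locally compact, second countable, Hausdorff group with its Borel sets
    [Group G] [TopologicalSpace G] [IsTopologicalGroup G] [LocallyCompactSpace G]
    [SecondCountableTopology G] [T2Space G] [MeasurableSpace G] [BorelSpace G]
    -- the spaces of `X`, of `Y` and of the maximal invariant
    [TopologicalSpace E] [MeasurableSpace E] [BorelSpace E] [StandardBorelSpace E]
    [TopologicalSpace F] [MeasurableSpace F] [BorelSpace F] [StandardBorelSpace F]
    [MeasurableSpace N] [StandardBorelSpace N]
    -- continuous actions, the one on `E` proper
    [MulAction G E] [ContinuousSMul G E] [MulAction G F] [ContinuousSMul G F]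
    (hproper : IsProperAction G E)
    [MeasurableSpace Ω] (μ : Measure Ω) [IsProbabilityMeasure μ]
    (X : Ω → E) (hX : Measurable X) (Y : Ω → F) (hY : Measurable Y) :
    -- a measurable inversion kernel exists
    (∃ (γ : E → E) (ζ : E → Measure G),
      AEMeasurable γ (μ.map X) ∧ AEMeasurable ζ (μ.map X) ∧
      IsOrbitSelectorOn G Set.univ γ ∧ IsInversionKernelOn Set.univ γ ζ) ∧
    -- `S` is a set of full measure on which the defining properties hold
    ∀ (S : Set E), μ.map X Sᶜ = 0 →
    ∀ (M : E → N), AEMeasurable M (μ.map X) → IsMaximalInvariantOn G S M →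
      -- the characterization by means of an inversion kernel
      (∀ (γ : E → E) (ζ : E → Measure G),
        AEMeasurable γ (μ.map X) → IsOrbitSelectorOn G S γ →
        AEMeasurable ζ (μ.map X) → IsInversionKernelOn S γ ζ →
        ∀ T : Ω → G, Measurable T → IsDrawnFrom μ X Y ζ T →
          (CondDistribEquivariant G μ X Y ↔
            CondIndepGiven μ (fun ω => (T ω, X ω)) (fun ω => (T ω)⁻¹ • Y ω)
              (fun ω => M (X ω)))) ∧
      -- the case of a measurable representative inversion
      (∀ (γ : E → E) (τ : E → G),
        AEMeasurable γ (μ.map X) → IsOrbitSelectorOn G S γ →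
        AEMeasurable τ (μ.map X) → IsRepresentativeInversionOn S γ τ →
          (CondDistribEquivariant G μ X Y ↔
            CondIndepGiven μ X (fun ω => (τ (X ω))⁻¹ • Y ω) (fun ω => M (X ω)))) ∧
      -- the case of a trivial action on `F`
      ((∀ (g : G) (y : F), g • y = y) →
        (CondDistribEquivariant G μ X Y ↔ CondIndepGiven μ X Y (fun ω => M (X ω))))
  := by
  have : PolishSpace G := polishSpace_of_locallyCompact_group G
  have hP := Measure.isProbabilityMeasure_map (μ := μ) hX.aemeasurable
  obtain ⟨W, _, hW⟩ := hproper.exists_equivariant_kernel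
  refine ⟨hproper.exists_inversionKernel (μ.map X), fun S hPS M hM hMS => ⟨?_, ?_, ?_⟩⟩
  all_goals have hSae : ∀ᵐ x ∂μ.map X, x ∈ S := hPS
  · intro γ ζ hγ hγS hζ hζS T hT hdrawn
    -- On the Borel set `S'` of full measure, `M` and `ζ` coincide with Borel versions, so their
    -- defining properties pass to these versions.
    obtain ⟨S', hS'm, hPS', hS'⟩ := exists_measurableSet_of_ae
      (hSae.and (hM.ae_eq_mk.and hζ.ae_eq_mk))
    obtain ⟨κ, _, hκ⟩ := exists_markovKernel_eq_on hζ.measurable_mk hS'm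
      (fun x hx => (hS' x hx).2.2) fun x hx => hζS.isProb x (hS' x hx).1
    have hsub : S' ⊆ S := fun x hx => (hS' x hx).1
    have hMS' : IsMaximalInvariantOn G S' (hM.mk M) :=
      hMS.congr hsub fun x hx => (hS' x hx).2.1
    have hS'ae : ∀ᵐ x ∂μ.map X, x ∈ S' := hPS'
    have hWM : (fun ω => M (X ω)) =ᵐ[μ] fun ω => hM.mk M ((T ω, X ω) : G × E).2 :=
      ae_of_ae_map hX.aemeasurable hM.ae_eq_mk
    have hVm : Measurable fun ω => (T ω)⁻¹ • Y ω := hT.inv.smul hY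
    rw [condIndepGiven_iff_exists_kernel (hT.prodMk hX).aemeasurable hVm.aemeasurable
      (hM.measurable_mk.comp measurable_snd) hWM]
    refine condDistribEquivariant_iff_exists_kernel W hW hX hY hT.aemeasurable κ
      (hdrawn.map_eq_compProd hX hY hT κ (hS'ae.mono hκ)) hS'm hPS' hM.measurable_mk hMS' hγ
      (hγS.mono hsub) (fun x hx => ?_) fun x hx g hgx => ?_
    · rw [hκ x hx]
      exact hζS.inverts x (hsub hx)
    · rw [hκ x hx, hκ _ hgx]
      ext B hB
      rw [hζS.equivariant x (hsub hx) g B hB, Measure.map_apply (measurable_const_mul g) hB,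
        ← Set.preimage_smul]
      rfl
  · intro γ τ hγ hγS hτ hτS
    obtain ⟨S', hS'm, hPS', hS'⟩ := exists_measurableSet_of_ae
      (hSae.and (hM.ae_eq_mk.and hτ.ae_eq_mk))
    have hsub : S' ⊆ S := fun x hx => (hS' x hx).1
    have hMS' : IsMaximalInvariantOn G S' (hM.mk M) :=
      hMS.congr hsub fun x hx => (hS' x hx).2.1
    have hτm := hτ.measurable_mk
    have hTm : Measurable fun ω => hτ.mk τ (X ω) := hτm.comp hX
    have hτX : ∀ᵐ ω ∂μ, τ (X ω) = hτ.mk τ (X ω) := ae_of_ae_map hX.aemeasurable hτ.ae_eq_mk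
    have hVm : Measurable fun ω => (hτ.mk τ (X ω))⁻¹ • Y ω := hTm.inv.smul hY
    have hV : (fun ω => (τ (X ω))⁻¹ • Y ω) =ᵐ[μ] fun ω => (hτ.mk τ (X ω))⁻¹ • Y ω := by
      filter_upwards [hτX] with ω hω
      rw [hω]
    have hWM : (fun ω => M (X ω)) =ᵐ[μ] fun ω => hM.mk M (X ω) :=
      ae_of_ae_map hX.aemeasurable hM.ae_eq_mk
    have hXVm : Measurable fun ω => (X ω, (hτ.mk τ (X ω))⁻¹ • Y ω) := hX.prodMk hVm
    have hpair : (fun ω => (X ω, (τ (X ω))⁻¹ • Y ω)) =ᵐ[μ]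
        fun ω => (X ω, (hτ.mk τ (X ω))⁻¹ • Y ω) := by
      filter_upwards [hV] with ω hω
      rw [hω]
    rw [condIndepGiven_iff_exists_kernel hX.aemeasurable
      (hVm.aemeasurable.congr hV.symm) hM.measurable_mk hWM, Measure.map_congr hpair]
    refine (condDistribEquivariant_iff_exists_kernel W hW hX hY hTm.aemeasurable
      (Kernel.deterministic _ hτm) ?_ hS'm hPS' hM.measurable_mk hMS' hγ
      (hγS.mono hsub) (fun x hx => ?_) fun x hx g hgx => ?_).trans
      (exists_congr fun η => and_congr_right fun hη => ?_)
    · have hXY : Measurable fun ω => (X ω, Y ω) := hX.prodMk hY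
      have := Measure.isProbabilityMeasure_map (μ := μ) hXY.aemeasurable
      have hm : Measurable fun p : E × F => hτ.mk τ p.1 := hτm.comp measurable_fst
      have hd : (Kernel.deterministic _ hτm).comap Prod.fst measurable_fst =
          Kernel.deterministic _ hm := rfl
      rw [hd, Measure.compProd_deterministic, Measure.map_map (by fun_prop) hXY]
      rfl
    · rw [Kernel.deterministic_apply, ← (hS' x hx).2.2]
      refine (ae_dirac_iff ?_).2 (hτS x (hsub hx)).1
      exact (measurable_smul_const (γ x)) (measurableSet_singleton x)
    · rw [Kernel.deterministic_apply, Kernel.deterministic_apply,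
        Measure.map_dirac' (measurable_const_mul g), ← (hS' x hx).2.2, ← (hS' _ hgx).2.2,
        (hτS x (hsub hx)).2 g]
    · have hj : Measurable fun x : E => (hτ.mk τ x, x) := hτm.prodMk measurable_id
      have hj2 : Measurable fun p : E × F => ((hτ.mk τ p.1, p.1), p.2) := by fun_prop
      have hs2 : Measurable fun p : (G × E) × F => (p.1.2, p.2) := by fun_prop
      have hTX : μ.map (fun ω => (hτ.mk τ (X ω), X ω)) =
          (μ.map X).map fun x => (hτ.mk τ x, x) := by
        rw [Measure.map_map hj hX]
        rfl
      have hTXV : μ.map (fun ω => ((hτ.mk τ (X ω), X ω), (hτ.mk τ (X ω))⁻¹ • Y ω)) =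
          (μ.map fun ω => (X ω, (hτ.mk τ (X ω))⁻¹ • Y ω)).map
            fun p => ((hτ.mk τ p.1, p.1), p.2) := by
        rw [Measure.map_map hj2 hXVm]
        rfl
      have hcp : μ.map (fun ω => (hτ.mk τ (X ω), X ω)) ⊗ₘ
          η.comap (fun p : G × E => hM.mk M p.2) (hM.measurable_mk.comp measurable_snd) =
          (μ.map X ⊗ₘ η.comap (hM.mk M) hM.measurable_mk).map
            fun p => ((hτ.mk τ p.1, p.1), p.2) := by
        have := Measure.isProbabilityMeasure_map (μ := μ.map X) hj.aemeasurable
        rw [hTX]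
        refine Measure.ext_of_lintegral _ fun u hu => ?_
        have hum := Measurable.lintegral_kernel_prod_right' (κ := η.comap
          (fun p : G × E => hM.mk M p.2) (hM.measurable_mk.comp measurable_snd)) hu
        rw [Measure.lintegral_compProd hu, lintegral_map hum hj, lintegral_map hu hj2]
        exact (Measure.lintegral_compProd (μ := μ.map X)
          (κ := η.comap (hM.mk M) hM.measurable_mk) (hu.comp hj2)).symm
      rw [hTXV, hcp]
      -- With `T = τ (X)` the coordinate `T` is redundant: `(x, y) ↦ ((τ x, x), y)` has a measurable
      -- left inverse, so equality of the image laws gives equality of the laws.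
      refine ⟨fun h => ?_, fun h => by rw [h]⟩
      have h' := congrArg (Measure.map fun p : (G × E) × F => (p.1.2, p.2)) h
      rw [Measure.map_map hs2 hj2, Measure.map_map hs2 hj2] at h'
      have hid : (fun p : (G × E) × F => (p.1.2, p.2)) ∘
          (fun p : E × F => ((hτ.mk τ p.1, p.1), p.2)) = id := rfl
      rwa [hid, Measure.map_id, Measure.map_id] at h'
  · intro htriv
    obtain ⟨S', hS'm, hPS', hS'⟩ := exists_measurableSet_of_ae (hSae.and hM.ae_eq_mk)
    have hMS' : IsMaximalInvariantOn G S' (hM.mk M) :=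
      hMS.congr (fun x hx => (hS' x hx).1) fun x hx => (hS' x hx).2
    have hWM : (fun ω => M (X ω)) =ᵐ[μ] fun ω => hM.mk M (X ω) :=
      ae_of_ae_map hX.aemeasurable hM.ae_eq_mk
    have hmapid : ∀ (g : G) (ν : Measure F), ν.map (fun y => g • y) = ν := by
      intro g ν
      simp [htriv]
    rw [condIndepGiven_iff_exists_kernel hX.aemeasurable hY.aemeasurable hM.measurable_mk hWM]
    constructor
    · rintro ⟨Q, hQ, hQlaw, hQe⟩
      rw [forall_smul_set_eq_iff_forall_map_smul] at hQe
      have : Nonempty E := (μ.map X).nonempty_of_neZero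
      -- `Q` is constant on orbits, so `Q x = Q (γ x)`, and `γ` factors through `M` almost
      -- everywhere.
      obtain ⟨γ, -, hγ, -, hγS, -⟩ := hproper.exists_inversionKernel (μ.map X)
      obtain ⟨s, hs, hsae⟩ := exists_measurable_ae_factor hM.measurable_mk.aemeasurable hγ hPS'
        fun x hx x' hx' h => hγS.2 x trivial x' trivial ((hMS' x hx x' hx').1 h)
      refine ⟨Q.comap s hs, inferInstance, hQlaw.trans (Measure.compProd_congr ?_)⟩
      filter_upwards [hsae] with x hx
      obtain ⟨g, hg⟩ := hγS.1 x trivial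
      rw [Kernel.comap_apply, Kernel.comap_apply, ← hx, ← hg]
      exact ((hQe g x).trans (hmapid g _)).symm
    · rintro ⟨η, hη, hηlaw⟩
      refine condDistribEquivariant_of_equivariant_on W hW hX _ hηlaw hS'm hPS'
        fun x hx g hgx => ?_
      rw [hmapid, Kernel.comap_apply, Kernel.comap_apply,
        (hMS' _ hgx _ hx).2 (MulAction.mem_orbit x g)]
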